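/- Let \(L\) be a compact connected Lie group, let \(T \subseteq L\) be a maximal torus (a Lie subgroup that is isomorphic as a Lie group to \((\mathbb{S}^1)^n\) for some \(n \ge 0\), and maximal under inclusion among all such subgroups), and let \(\mu_L\) and \(\mu_T\) be Haar measures on \(L\) and \(T\). Define \(\psi : L/T \times T \to L\) by \(\psi(vT, t) = v t v^{-1}\). Let \(U\) be a random element of \(L\), and let \((U_{L/T}, U_T)\) be a random preimage of \(U\), that is, a random element of \(L/T \times T\), defined on the same probability space as \(U\), such that \((U_{L/T}, U_T) \in \psi^{-1}(U)\) almost surely. If \(\mathrm{Law}(U) \ll \mu_L\), then \(\mathrm{Law}(U_T) \ll \mu_T\). -/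

import Mathlib

open MeasureTheory
open scoped Manifold ContDiff

/-- The standard model with corners on the torus `(S¹)ⁿ`, the product of `n` copies of the
standard model of the circle. -/
noncomputable abbrev torusModel (n : ℕ) :
    ModelWithCorners ℝ (Fin n → EuclideanSpace ℝ (Fin 1))
      (ModelPi fun _ : Fin n => EuclideanSpace ℝ (Fin 1)) :=
  ModelWithCorners.pi fun _ : Fin n => 𝓡 1

/-- A subgroup `T` of a Lie group `L` is a torus in `L` if it is a Lie subgroup that is isomorphic,
as a Lie group, to some `(S¹)ⁿ`: it is the image of `(S¹)ⁿ` under an injective smooth group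
homomorphism that is an immersion. (As `(S¹)ⁿ` is compact, such a homomorphism is an embedding, so
the Lie group topology of `T` is the subspace topology.) -/
def IsTorusIn {E H : Type*} [NormedAddCommGroup E] [NormedSpace ℝ E] [TopologicalSpace H]
    (I : ModelWithCorners ℝ E H) {L : Type*} [Group L] [TopologicalSpace L] [ChartedSpace H L]
    (T : Subgroup L) : Prop :=
  ∃ (n : ℕ) (f : (Fin n → Circle) →* L),
    Function.Injective f ∧ ContMDiff (torusModel n) I ∞ f ∧
      (∀ x, Function.Injective (mfderiv (torusModel n) I f x)) ∧ f.range = T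

/-- A maximal torus: a torus in `L` that is maximal, under inclusion, among the tori in `L`. -/
def IsMaximalTorus {E H : Type*} [NormedAddCommGroup E] [NormedSpace ℝ E] [TopologicalSpace H]
    (I : ModelWithCorners ℝ E H) {L : Type*} [Group L] [TopologicalSpace L] [ChartedSpace H L]
    (T : Subgroup L) : Prop :=
  Maximal (IsTorusIn I) T

theorem IsMaximalTorus.mul_comm_of_mem {E H : Type*} [NormedAddCommGroup E] [NormedSpace ℝ E]
    [TopologicalSpace H] {I : ModelWithCorners ℝ E H} {L : Type*} [Group L] [TopologicalSpace L]
    [ChartedSpace H L] {T : Subgroup L} (hT : IsMaximalTorus I T) {s t : L} (hs : s ∈ T)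
    (ht : t ∈ T) : s * t = t * s := by
  obtain ⟨n, f, -, -, -, rfl⟩ := hT.prop
  obtain ⟨a, rfl⟩ := hs
  obtain ⟨b, rfl⟩ := ht
  rw [← map_mul, ← map_mul, mul_comm]

/-- The map `ψ : L/T × T → L`, `ψ(vT, t) = v t v⁻¹`, for a maximal torus `T` of `L`
(well defined because `T` is commutative). -/
def conjMap {E H : Type*} [NormedAddCommGroup E] [NormedSpace ℝ E] [TopologicalSpace H]
    {I : ModelWithCorners ℝ E H} {L : Type*} [Group L] [TopologicalSpace L] [ChartedSpace H L]
    {T : Subgroup L} (hT : IsMaximalTorus I T) (p : (L ⧸ T) × T) : L :=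
  Quotient.liftOn' p.1 (fun v => v * (p.2 : L) * v⁻¹) fun v w hvw => by
    have h : v⁻¹ * w ∈ T := QuotientGroup.leftRel_apply.mp hvw
    have hc := hT.mul_comm_of_mem h p.2.2
    calc v * (p.2 : L) * v⁻¹ = v * ((p.2 : L) * (v⁻¹ * w)) * w⁻¹ := by group
      _ = v * (v⁻¹ * w * p.2) * w⁻¹ := by rw [hc]
      _ = w * p.2 * w⁻¹ := by group

@[simp]
theorem conjMap_mk {E H : Type*} [NormedAddCommGroup E] [NormedSpace ℝ E] [TopologicalSpace H]
    {I : ModelWithCorners ℝ E H} {L : Type*} [Group L] [TopologicalSpace L] [ChartedSpace H L]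
    {T : Subgroup L} (hT : IsMaximalTorus I T) (v : L) (t : T) :
    conjMap hT ((v : L ⧸ T), t) = v * t * v⁻¹ := rfl

/-- The random pair `(V, Z) ∈ L/T × T` is a random preimage of the random element `U` of `L` if
almost surely `(V, Z) ∈ ψ⁻¹(U)`. Here `L/T` carries the Borel `σ`-algebra of its quotient
topology. -/
structure IsRandomPreimage {E H : Type*} [NormedAddCommGroup E] [NormedSpace ℝ E]
    [TopologicalSpace H] {I : ModelWithCorners ℝ E H} {L : Type*} [Group L] [TopologicalSpace L]
    [ChartedSpace H L] [MeasurableSpace L] {T : Subgroup L} (hT : IsMaximalTorus I T)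
    {Ω : Type*} [MeasurableSpace Ω] (P : Measure Ω) (U : Ω → L) (V : Ω → L ⧸ T) (Z : Ω → T) :
    Prop where
  measurable_coset : Measurable[_, borel (L ⧸ T)] V
  measurable_torus : Measurable Z
  ae_mem : ∀ᵐ x ∂P, (V x, Z x) ∈ conjMap hT ⁻¹' {U x}

/-! The heart is `measure_conj_image_eq_zero`: if `K ⊆ T` is compact and Haar null, the union of its
conjugates is Haar null in `L`. Near `v₀`, write `v = v₀ s(w) e(q)` with `e(q) ∈ T` and `w` in a
complement `W` of the tangent space of `T` at `1`. As `T` is commutative, `e(q)` cancels in `v k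
v⁻¹`, so locally the union is a `C¹` image of a null subset of `W × Lie(T)`. This space has the
dimension of `L`, and `C¹` maps between equal dimensions preserve null sets.

Haar measure is never expressed by a density in charts: Fubini on the group transfers null sets both
ways. Finally, `Z ∈ K` almost surely forces `U` into the union of conjugates of `K`, and inner
regularity passes from compact to measurable sets. -/

open Set Filter Topology Module

/-! ### Null sets and translation in a topological group -/

section Fubini

variable {G : Type*} [Group G] [TopologicalSpace G] [IsTopologicalGroup G]
  [SecondCountableTopology G] [MeasurableSpace G] [BorelSpace G]

/-- Both sides are the product measure of `{(g, x) | g * x ∈ A}`, sliced in the two directions. -/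
theorem lintegral_measure_preimage_mul_left (μ ν : Measure G) [SFinite μ] [SFinite ν]
    {A : Set G} (hA : MeasurableSet A) :
    ∫⁻ g, ν ((fun x => g * x) ⁻¹' A) ∂μ = ∫⁻ x, μ ((fun g => g * x) ⁻¹' A) ∂ν := by
  have hm : MeasurableSet ((fun p : G × G => p.1 * p.2) ⁻¹' A) := measurable_mul hA
  have h1 := Measure.prod_apply (μ := μ) (ν := ν) hm
  have h2 := Measure.prod_apply_symm (μ := μ) (ν := ν) hm
  exact h1.symm.trans h2

/-- If all left translates of `A` are null for some nonzero measure, then `A` is Haar null. -/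
theorem measure_eq_zero_of_forall_preimage_mul_left (μ ν : Measure G) [SFinite μ]
    [μ.IsMulLeftInvariant] [SFinite ν] (hν : ν ≠ 0) {A : Set G} (hA : MeasurableSet A)
    (h : ∀ g, ν ((fun x => g * x) ⁻¹' A) = 0) : μ A = 0 := by
  have h1 := lintegral_measure_preimage_mul_left μ ν hA
  -- Left invariance alone makes the class of null sets invariant under right translation.
  have h2 : ∀ x, μ ((fun g => g * x) ⁻¹' A) = 0 → μ A = 0 :=
    fun x => (measure_mul_right_null μ x).1
  by_contra hne
  simp only [h, lintegral_zero] at h1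
  have hm : Measurable fun x => μ ((fun g => g * x) ⁻¹' A) :=
    measurable_measure_prodMk_right (measurable_mul hA)
  rw [eq_comm, lintegral_eq_zero_iff hm] at h1
  have : (ae ν).NeBot := ae_neBot.2 hν
  obtain ⟨x, hx⟩ := h1.exists
  exact hne (h2 x hx)

/-- Almost all left translates of a Haar null set are null for any given s-finite measure. -/
theorem ae_preimage_mul_left_eq_zero (μ ν : Measure G) [SFinite μ]
    [μ.IsMulLeftInvariant] [SFinite ν] {A : Set G} (hA : MeasurableSet A) (h : μ A = 0) :
    ∀ᵐ g ∂μ, ν ((fun x => g * x) ⁻¹' A) = 0 := by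
  have h1 := lintegral_measure_preimage_mul_left μ ν hA
  simp only [fun x => (measure_mul_right_null μ x).2 h, lintegral_zero] at h1
  exact (lintegral_eq_zero_iff (measurable_measure_prodMk_left (measurable_mul hA))).1 h1

end Fubini

/-! ### Null sets under differentiable maps in equal dimension -/

section Charts

variable {E H : Type*} [NormedAddCommGroup E] [NormedSpace ℝ E]
    [FiniteDimensional ℝ E] [TopologicalSpace H] (I : ModelWithCorners ℝ E H)
    {L : Type*} [TopologicalSpace L] [ChartedSpace H L]
    {F : Type*} [NormedAddCommGroup F] [NormedSpace ℝ F] [FiniteDimensional ℝ F]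
    [MeasurableSpace E] [BorelSpace E] [MeasurableSpace F] [BorelSpace F]

/-- A differentiable map between spaces of equal dimension maps null sets to null sets. -/
theorem addHaar_image_eq_zero_of_finrank_eq (hd : finrank ℝ F = finrank ℝ E)
    (lF : Measure F) [lF.IsAddHaarMeasure] (lE : Measure E) [lE.IsAddHaarMeasure]
    {f : F → E} {N : Set F} (hf : DifferentiableOn ℝ f N) (hN : lF N = 0) : lE (f '' N) = 0 := by
  -- A linear isomorphism reduces to a self-map of `E`; any two additive Haar measures have the same
  -- null sets.
  let e : F ≃L[ℝ] E := ContinuousLinearEquiv.ofFinrankEq hd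
  have h1 : (lF.map e) (e '' N) = 0 := by
    refine (e.toHomeomorph.toMeasurableEquiv.map_apply (e '' N)).trans ?_
    convert hN
    exact e.injective.preimage_image N
  have : (lF.map e).IsAddHaarMeasure := e.isAddHaarMeasure_map lF
  have h2 : lE (e '' N) = 0 := Measure.absolutelyContinuous_isAddHaarMeasure lE (lF.map e) h1
  have h3 : DifferentiableOn ℝ (f ∘ e.symm) (e '' N) :=
    hf.comp e.symm.differentiable.differentiableOn (by rintro _ ⟨x, hx, rfl⟩; simpa using hx)
  have h4 := addHaar_image_eq_zero_of_differentiableOn_of_addHaar_eq_zero lE h3 h2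
  rwa [← image_comp, Function.comp_assoc, show (e.symm : E → F) ∘ e = id from by ext; simp,
    Function.comp_id] at h4

/-- A `C¹` map from a vector space to a manifold of the same dimension maps null sets to sets
which are null in every chart. -/
theorem addHaar_extChartAt_image_eq_zero [IsManifold I 1 L] (hd : finrank ℝ F = finrank ℝ E)
    (lF : Measure F) [lF.IsAddHaarMeasure] (lE : Measure E) [lE.IsAddHaarMeasure] (x₀ : L)
    {Ψ : F → L} {N : Set F} (hΨ : ∀ z ∈ N, ContMDiffAt 𝓘(ℝ, F) I 1 Ψ z) (hN : lF N = 0) :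
    lE ((extChartAt I x₀).target ∩ (extChartAt I x₀).symm ⁻¹' (Ψ '' N)) = 0 := by
  set N' := N ∩ Ψ ⁻¹' (extChartAt I x₀).source
  have hdiff : DifferentiableOn ℝ (extChartAt I x₀ ∘ Ψ) N' := by
    rintro z ⟨hz, hz'⟩
    have h1 : ContMDiffAt I 𝓘(ℝ, E) 1 (extChartAt I x₀) (Ψ z) :=
      contMDiffAt_extChartAt' (by simpa using hz')
    have h2 := h1.comp z (hΨ z hz)
    exact (h2.contDiffAt.differentiableAt (by simp)).differentiableWithinAt
  refine measure_mono_null ?_ (addHaar_image_eq_zero_of_finrank_eq hd lF lE hdiff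
    (measure_mono_null inter_subset_left hN))
  rintro y ⟨hy, z, hz, hzy⟩
  refine ⟨z, ⟨hz, ?_⟩, ?_⟩
  · simpa only [mem_preimage, hzy] using (extChartAt I x₀).map_target hy
  · simp only [Function.comp_apply, hzy]
    exact (extChartAt I x₀).right_inv hy

end Charts

/-! ### Local product decomposition near the identity -/

section LieGroup

variable {E H : Type*} [NormedAddCommGroup E] [NormedSpace ℝ E] [TopologicalSpace H] (I : ModelWithCorners ℝ E H) [I.Boundaryless]
    {L : Type*} [Group L] [TopologicalSpace L] [ChartedSpace H L] [LieGroup I 1 L]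
    {F : Type*} [NormedAddCommGroup F] [NormedSpace ℝ F]

theorem contMDiffAt_extChartAt_symm_add (W : Submodule ℝ E) {w : W}
    (hw : extChartAt I (1 : L) 1 + w ∈ (extChartAt I (1 : L)).target) :
    ContMDiffAt 𝓘(ℝ, W) I 1
      (fun w : W => (extChartAt I (1 : L)).symm (extChartAt I (1 : L) 1 + w)) w := by
  have h1 : ContMDiffAt 𝓘(ℝ, E) I 1 (extChartAt I (1 : L)).symm (extChartAt I (1 : L) 1 + w) :=
    (contMDiffOn_extChartAt_symm (1 : L)).contMDiffAt
      ((isOpen_extChartAt_target (1 : L)).mem_nhds hw)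
  refine ContMDiffAt.comp (g := (extChartAt I (1 : L)).symm)
    (f := fun w : W => extChartAt I (1 : L) 1 + (w : E)) w h1 ?_
  exact (contDiff_const.add W.subtypeL.contDiff).contMDiff.contMDiffAt

/-- Given a parametrized submanifold `e` through `1` and a complement `W` of its tangent space,
the products of small elements of `W`, seen in the chart, with values of `e` near the base point
fill a neighbourhood of `1`. -/
theorem nhds_one_le_map_mul [FiniteDimensional ℝ E] [FiniteDimensional ℝ F]
    (W : Submodule ℝ E) {e : F → L} {q₀ : F} (he₀ : e q₀ = 1)
    (he : ContMDiffAt 𝓘(ℝ, F) I 1 e q₀)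
    (hW : ∀ y : E, ∃ (w : W) (q : F),
      (w : E) + fderiv ℝ (extChartAt I (1 : L) ∘ e) q₀ q = y) :
    𝓝 (1 : L) ≤ map (fun z : W × F =>
      (extChartAt I (1 : L)).symm (extChartAt I (1 : L) 1 + z.1) * e z.2) (𝓝 (0, q₀)) := by
  set φ := extChartAt I (1 : L) with hφ
  set G : W × F → L := fun z => φ.symm (φ 1 + z.1) * e z.2 with hG
  have hG₀ : G (0, q₀) = 1 := by simp [hG, he₀, hφ]
  have hGs : ContMDiffAt 𝓘(ℝ, W × F) I 1 G (0, q₀) := by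
    refine ContMDiffAt.mul ?_ ?_
    · refine ContMDiffAt.comp (g := fun w : W => φ.symm (φ 1 + w)) (f := fun z : W × F => z.1)
        (I' := 𝓘(ℝ, W)) (0, q₀) (contMDiffAt_extChartAt_symm_add I W ?_)
        contDiff_fst.contMDiff.contMDiffAt
      simp
    · exact ContMDiffAt.comp (g := e) (f := fun z : W × F => z.2)
        (I' := 𝓘(ℝ, F)) (0, q₀) he contDiff_snd.contMDiff.contMDiffAt
  have hφ1 : ContMDiffAt I 𝓘(ℝ, E) 1 φ (1 : L) := contMDiffAt_extChartAt
  have hΓ : ContDiffAt ℝ 1 (φ ∘ G) (0, q₀) :=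
    (ContMDiffAt.comp (0, q₀) (by rwa [hG₀]) hGs).contDiffAt
  have hΓ' : HasStrictFDerivAt (φ ∘ G) (fderiv ℝ (φ ∘ G) (0, q₀)) (0, q₀) :=
    hΓ.hasStrictFDerivAt (by simp)
  have hinl : ∀ w : W, fderiv ℝ (φ ∘ G) (0, q₀) (w, 0) = w := by
    have h1 : HasFDerivAt ((φ ∘ G) ∘ fun w : W => (w, q₀))
        ((fderiv ℝ (φ ∘ G) (0, q₀)).comp (ContinuousLinearMap.inl ℝ W F)) 0 :=
      HasFDerivAt.comp (0 : W) (f := fun w : W => (w, q₀)) hΓ'.hasFDerivAt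
        (hasFDerivAt_prodMk_left (0 : W) q₀)
    have h2 : HasFDerivAt (fun w : W => φ 1 + (w : E)) W.subtypeL 0 :=
      W.subtypeL.hasFDerivAt.const_add _
    have h3 : ((φ ∘ G) ∘ fun w : W => (w, q₀)) =ᶠ[𝓝 0] fun w : W => φ 1 + (w : E) := by
      have hc : ContinuousAt (fun w : W => φ 1 + (w : E)) 0 := by fun_prop
      have : ∀ᶠ w : W in 𝓝 0, φ 1 + (w : E) ∈ φ.target :=
        hc ((isOpen_extChartAt_target (1 : L)).mem_nhds (by simp [hφ]))
      filter_upwards [this] with w hw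
      simp [hG, he₀, φ.right_inv hw]
    have h4 := h1.unique (h2.congr_of_eventuallyEq h3)
    intro w
    simpa using DFunLike.congr_fun h4 w
  have hinr : ∀ q : F, fderiv ℝ (φ ∘ G) (0, q₀) (0, q) = fderiv ℝ (φ ∘ e) q₀ q := by
    have h1 : HasFDerivAt ((φ ∘ G) ∘ fun q : F => ((0 : W), q))
        ((fderiv ℝ (φ ∘ G) (0, q₀)).comp (ContinuousLinearMap.inr ℝ W F)) q₀ :=
      HasFDerivAt.comp q₀ (f := fun q : F => ((0 : W), q)) hΓ'.hasFDerivAt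
        (hasFDerivAt_prodMk_right (0 : W) q₀)
    have h3 : ((φ ∘ G) ∘ fun q : F => ((0 : W), q)) = φ ∘ e := by
      ext q
      simp [hG, hφ]
    rw [h3] at h1
    intro q
    rw [h1.fderiv]
    simp
  -- The derivative is `(w, q) ↦ w + D q`, with `D` the derivative of `e` in the chart. Surjectivity
  -- suffices: a strictly differentiable map with onto derivative is open at the point.
  have hsurj : (fderiv ℝ (φ ∘ G) (0, q₀)).range = ⊤ := by
    refine LinearMap.range_eq_top.2 fun y => ?_
    obtain ⟨w, q, hwq⟩ := hW y
    refine ⟨(w, q), ?_⟩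
    have : ((w, q) : W × F) = (w, 0) + (0, q) := by simp
    rw [this, map_add]
    simpa only [ContinuousLinearMap.coe_coe, hinl, hinr] using hwq
  have hmap := hΓ'.map_nhds_eq_of_surj hsurj
  intro S hS
  have hsrc : ∀ᶠ z in 𝓝 ((0 : W), q₀), G z ∈ φ.source := by
    refine hGs.continuousAt.eventually_mem ?_
    rw [hG₀]
    exact extChartAt_source_mem_nhds (1 : L)
  have h5 : (φ ∘ G) '' (G ⁻¹' S ∩ G ⁻¹' φ.source) ∈ 𝓝 (φ 1) := by
    have h6 : (φ ∘ G) (0, q₀) = φ 1 := by simp [hG₀]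
    rw [← h6, ← hmap]
    exact image_mem_map (inter_mem hS hsrc)
  filter_upwards [(continuousAt_extChartAt (1 : L)).preimage_mem_nhds h5,
    extChartAt_source_mem_nhds (I := I) (1 : L)] with x hx hxs
  obtain ⟨z, ⟨hzS, hzs⟩, hzx⟩ := hx
  have : G z = x := φ.injOn hzs hxs hzx
  rwa [← this]

end LieGroup

/-! ### Smooth maps in a chart of the source -/

section WrittenInCharts

variable {E H : Type*} [NormedAddCommGroup E] [NormedSpace ℝ E]
    [TopologicalSpace H] (I : ModelWithCorners ℝ E H) [I.Boundaryless]
    {L : Type*} [TopologicalSpace L] [ChartedSpace H L] [IsManifold I 1 L]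
    {E' H' : Type*} [NormedAddCommGroup E'] [NormedSpace ℝ E']
    [TopologicalSpace H'] (J : ModelWithCorners ℝ E' H') [J.Boundaryless]
    {M : Type*} [TopologicalSpace M] [ChartedSpace H' M]

theorem contMDiffAt_comp_extChartAt_symm {f : M → L} {x : M} (hf : ContMDiffAt J I 1 f x) :
    ContMDiffAt 𝓘(ℝ, E') I 1 (f ∘ (extChartAt J x).symm) (extChartAt J x x) := by
  obtain ⟨hc, hd⟩ := contMDiffAt_iff.1 hf
  rw [J.range_eq_univ, contDiffWithinAt_univ] at hd
  have h1 : ContMDiffAt 𝓘(ℝ, E) I 1 (extChartAt I (f x)).symm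
      ((extChartAt I (f x) ∘ f ∘ (extChartAt J x).symm) (extChartAt J x x)) := by
    refine (contMDiffOn_extChartAt_symm (f x)).contMDiffAt
      ((isOpen_extChartAt_target (f x)).mem_nhds ?_)
    simp
  refine (h1.comp _ hd.contMDiffAt).congr_of_eventuallyEq ?_
  have h2 : ContinuousAt (f ∘ (extChartAt J x).symm) (extChartAt J x x) :=
    ContinuousAt.comp (by simpa using hc) (continuousAt_extChartAt_symm x)
  have h3 : ∀ᶠ q in 𝓝 (extChartAt J x x),
      (f ∘ (extChartAt J x).symm) q ∈ (extChartAt I (f x)).source :=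
    h2.eventually_mem (by simpa using extChartAt_source_mem_nhds (I := I) (f x))
  filter_upwards [h3] with q hq
  simpa using ((extChartAt I (f x)).left_inv hq).symm

end WrittenInCharts

/-! ### Conjugates of a null subset of the torus -/

section ConjugateNull

variable {E H : Type*} [NormedAddCommGroup E] [NormedSpace ℝ E]
    [FiniteDimensional ℝ E] [TopologicalSpace H] (I : ModelWithCorners ℝ E H) [I.Boundaryless]
    {L : Type*} [Group L] [TopologicalSpace L] [ChartedSpace H L] [LieGroup I 1 L]
    {E' H' : Type*} [NormedAddCommGroup E'] [NormedSpace ℝ E']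
    [FiniteDimensional ℝ E'] [TopologicalSpace H'] (J : ModelWithCorners ℝ E' H') [J.Boundaryless]
    {M : Type*} [CommGroup M] [TopologicalSpace M] [ChartedSpace H' M]
    [MeasurableSpace L] [BorelSpace L] [SecondCountableTopology L] [CompactSpace L]
    [T2Space L] [IsTopologicalGroup M] [CompactSpace M] [MeasurableSpace M] [BorelSpace M]
    [SecondCountableTopology M] [T2Space M]

/-- Let `f : M → L` be a homomorphism from a compact commutative Lie group to a compact Lie group
which is an immersion. The union of the conjugates of the image of a compact Haar null set
is Haar null. -/
theorem measure_conj_image_eq_zero (f : M →* L) (hfc : Continuous f)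
    (hf : ContMDiffAt J I 1 f 1) (hinj : Function.Injective (mfderiv J I f 1))
    (μL : Measure L) [μL.IsHaarMeasure] (μM : Measure M) [μM.IsHaarMeasure]
    {K : Set M} (hK : IsCompact K) (hK0 : μM K = 0) :
    μL ((fun p : L × M => p.1 * f p.2 * p.1⁻¹) '' (univ ×ˢ K)) = 0 := by
  have : IsTopologicalGroup L := topologicalGroup_of_lieGroup I 1
  let : MeasurableSpace E := borel E
  have : BorelSpace E := ⟨rfl⟩
  let : MeasurableSpace E' := borel E'
  have : BorelSpace E' := ⟨rfl⟩
  set φ := extChartAt I (1 : L) with hφ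
  set c := extChartAt J (1 : M) with hc
  set q₀ := c 1 with hq₀
  set e : E' → L := f ∘ c.symm with he
  have he₀ : e q₀ = 1 := by simp [he, hq₀, hc]
  have hes : ContMDiffAt 𝓘(ℝ, E') I 1 e q₀ := contMDiffAt_comp_extChartAt_symm I J hf
  have hD : Function.Injective (fderiv ℝ (φ ∘ e) q₀) := by
    have h1 : mfderiv J I f 1 = fderiv ℝ (φ ∘ e) q₀ := by
      have h2 := (hf.mdifferentiableAt (by simp)).mfderiv
      rw [J.range_eq_univ, fderivWithin_univ] at h2
      refine h2.trans ?_
      simp only [writtenInExtChartAt, map_one]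
      rfl
    rw [h1] at hinj
    exact hinj
  set D := fderiv ℝ (φ ∘ e) q₀
  obtain ⟨W, hW⟩ := Submodule.exists_isCompl (LinearMap.range (D : E' →ₗ[ℝ] E))
  have hrank : finrank ℝ (W × E') = finrank ℝ E := by
    rw [finrank_prod, ← Submodule.finrank_add_eq_of_isCompl hW, add_comm,
      LinearMap.finrank_range_of_inj hD]
  have hspan : ∀ y : E, ∃ (w : W) (q : E'), (w : E) + D q = y := by
    intro y
    have : y ∈ LinearMap.range (D : E' →ₗ[ℝ] E) ⊔ W := by rw [hW.sup_eq_top]; trivial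
    obtain ⟨_, ⟨q, rfl⟩, w, hw, h⟩ := Submodule.mem_sup.1 this
    exact ⟨⟨w, hw⟩, q, by rw [← h, add_comm]; rfl⟩
  have hnhds := nhds_one_le_map_mul I W he₀ hes hspan
  set s : W → L := fun w => φ.symm (φ 1 + w) with hs
  set W₀ : Set W := {w | φ 1 + w ∈ φ.target} with hW₀
  have hW₀n : W₀ ∈ 𝓝 (0 : W) := by
    have h1 : ContinuousAt (fun w : W => φ 1 + (w : E)) 0 := by fun_prop
    exact h1 ((isOpen_extChartAt_target (1 : L)).mem_nhds (by simp [hφ]))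
  obtain ⟨O, hO, hOo, hqO⟩ : ∃ O ⊆ {q | ContMDiffAt 𝓘(ℝ, E') I 1 e q} ∩ c.target,
      IsOpen O ∧ q₀ ∈ O := by
    refine mem_nhds_iff.1 (inter_mem ?_ (extChartAt_target_mem_nhds (1 : M)))
    exact (contMDiffAt_iff_contMDiffAt_nhds (by simp)).1 hes
  have hV : (fun z : W × E' => s z.1 * e z.2) '' (W₀ ×ˢ O) ∈ 𝓝 (1 : L) :=
    hnhds (image_mem_map (prod_mem_nhds hW₀n (hOo.mem_nhds hqO)))
  set V := (fun z : W × E' => s z.1 * e z.2) '' (W₀ ×ˢ O)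
  set B : Set M := c.source ∩ c ⁻¹' O with hB
  have hBo : IsOpen B := (continuousOn_extChartAt (1 : M)).isOpen_inter_preimage
    (isOpen_extChartAt_source (1 : M)) hOo
  have h1B : (1 : M) ∈ B := ⟨by simp [hc], hqO⟩
  let lE : Measure E := Measure.addHaar
  let lE' : Measure E' := Measure.addHaar
  let lW : Measure W := Measure.addHaar
  -- Fubini for the chart's Lebesgue measure pushed to `M`: for almost every `m`, the translate `m⁻¹
  -- K` is Lebesgue null in the chart at `1`.
  have hae : ∀ᵐ m ∂μM, lE' ({q | m * c.symm q ∈ K} ∩ O) = 0 := by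
    have hcm : AEMeasurable c.symm (lE'.restrict O) :=
      ((continuousOn_extChartAt_symm (1 : M)).mono fun q hq => (hO hq).2).aemeasurable
        hOo.measurableSet
    filter_upwards [ae_preimage_mul_left_eq_zero μM ((lE'.restrict O).map c.symm)
      hK.measurableSet hK0] with m hm
    rw [Measure.map_apply_of_aemeasurable hcm
      (measurable_const_mul m hK.measurableSet)] at hm
    rwa [Measure.restrict_apply' hOo.measurableSet] at hm
  -- Restricting the pairs `(v, k)` to `R` lets compactness of `L × M` localize the claim.
  let orb : Set (L × M) → Set L :=
    fun R => (fun p : L × M => p.1 * f p.2 * p.1⁻¹) '' (R ∩ univ ×ˢ K)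
  have hchart : ∀ a : L, lE (φ.target ∩ φ.symm ⁻¹' ((fun x => a * x) ⁻¹' orb univ)) = 0 := by
    intro a
    have hmono : ∀ R R' : Set (L × M), R ⊆ R' →
        φ.target ∩ φ.symm ⁻¹' ((fun x => a * x) ⁻¹' orb R) ⊆
        φ.target ∩ φ.symm ⁻¹' ((fun x => a * x) ⁻¹' orb R') := fun R R' h =>
      inter_subset_inter_right _ (preimage_mono (preimage_mono
        (image_mono (inter_subset_inter_left _ h))))
    refine isCompact_univ.induction_on
      (p := fun R => lE (φ.target ∩ φ.symm ⁻¹' ((fun x => a * x) ⁻¹' orb R)) = 0) ?_ ?_ ?_ ?_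
    · simp [orb]
    · exact fun R R' h h' => measure_mono_null (hmono R R' h) h'
    · intro R R' h h'
      refine measure_mono_null ?_ (measure_union_null h h')
      simp only [orb, union_inter_distrib_right, image_union, preimage_union,
        inter_union_distrib_left]
      exact Subset.rfl
    · rintro ⟨v₀, m₀⟩ -
      have hopen : IsOpen {m : M | m⁻¹ * m₀ ∈ B} := hBo.preimage (by fun_prop)
      -- The centre `m₀` itself may be a bad translate, but good ones are dense, so one is taken
      -- with `m₀ ∈ m B`.
      obtain ⟨m, hmB, hm⟩ := (Measure.dense_of_ae hae).inter_open_nonempty _ hopen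
        ⟨m₀, by simpa using h1B⟩
      refine ⟨{v | v₀⁻¹ * v ∈ V} ×ˢ {k | m⁻¹ * k ∈ B}, ?_, ?_⟩
      · refine mem_nhdsWithin_of_mem_nhds (prod_mem_nhds ?_ ?_)
        · have hcv : ContinuousAt (fun v : L => v₀⁻¹ * v) v₀ := by fun_prop
          exact hcv (by simpa using hV)
        · exact (hBo.preimage (continuous_const_mul m⁻¹)).mem_nhds hmB
      · set N : Set (W × E') := W₀ ×ˢ ({q | m * c.symm q ∈ K} ∩ O) with hN
        have hN0 : (lW.prod lE') N = 0 := by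
          rw [hN, Measure.prod_prod, hm, mul_zero]
        -- This is `a⁻¹ v k v⁻¹` with `k = m c⁻¹(q)`. The torus factor of `v` has cancelled, so the
        -- domain is `W × E'` rather than `W × E' × E'`.
        have hΨ : ∀ z ∈ N, ContMDiffAt 𝓘(ℝ, W × E') I 1
            (fun z : W × E' => a⁻¹ * (v₀ * s z.1 * f m * e z.2 * (s z.1)⁻¹ * v₀⁻¹)) z := by
          rintro z ⟨hzw, -, hzO⟩
          have h1 : ContMDiffAt 𝓘(ℝ, W × E') I 1 (fun z : W × E' => s z.1) z :=
            ContMDiffAt.comp (g := s) (f := fun z : W × E' => z.1) (I' := 𝓘(ℝ, W)) z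
              (contMDiffAt_extChartAt_symm_add I W hzw) contDiff_fst.contMDiff.contMDiffAt
          have h2 : ContMDiffAt 𝓘(ℝ, W × E') I 1 (fun z : W × E' => e z.2) z :=
            ContMDiffAt.comp (g := e) (f := fun z : W × E' => z.2) (I' := 𝓘(ℝ, E')) z
              (hO hzO).1 contDiff_snd.contMDiff.contMDiffAt
          exact contMDiffAt_const.mul (((((contMDiffAt_const.mul h1).mul contMDiffAt_const).mul
            h2).mul h1.inv).mul contMDiffAt_const)
        refine measure_mono_null ?_
          (addHaar_extChartAt_image_eq_zero I hrank (lW.prod lE') lE (1 : L) hΨ hN0)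
        rintro y ⟨hy, ⟨v, k⟩, ⟨⟨⟨⟨w, q⟩, ⟨hw, hq⟩, hwq⟩, hkB⟩, -, hkK⟩, hvk⟩
        refine ⟨hy, (w, c (m⁻¹ * k)), ⟨hw, ?_, hkB.2⟩, ?_⟩
        · simpa [c.left_inv hkB.1] using hkK
        · have hek : e (c (m⁻¹ * k)) = f (m⁻¹ * k) := by simp [he, c.left_inv hkB.1]
          have hv : v = v₀ * (s w * e q) := by
            rw [show s w * e q = v₀⁻¹ * v from hwq]; group
          have hcomm : e q * f k = f k * e q := by
            rw [he, Function.comp_apply, ← map_mul, ← map_mul, mul_comm]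
          have hvk' : v * f k * v⁻¹ = a * φ.symm y := hvk
          have : φ.symm y = a⁻¹ * (v * f k * v⁻¹) := by rw [hvk']; group
          rw [this, hv]
          simp only [hek, map_mul, map_inv]
          calc a⁻¹ * (v₀ * s w * f m * ((f m)⁻¹ * f k) * (s w)⁻¹ * v₀⁻¹)
              = a⁻¹ * (v₀ * s w * (f k * e q) * (e q)⁻¹ * (s w)⁻¹ * v₀⁻¹) := by group
            _ = _ := by rw [← hcomm]; group
  have horb : IsClosed (orb univ) := by
    refine (IsCompact.image ?_ (by fun_prop)).isClosed
    rw [univ_inter]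
    exact isCompact_univ.prod hK
  have hφm : AEMeasurable φ.symm (lE.restrict φ.target) :=
    (continuousOn_extChartAt_symm (1 : L)).aemeasurable
      (isOpen_extChartAt_target (1 : L)).measurableSet
  -- The test measure for the converse Fubini argument is Lebesgue measure on the chart target,
  -- pushed to `L`.
  have hne : (lE.restrict φ.target).map φ.symm ≠ 0 := by
    rw [Ne, Measure.map_eq_zero_iff hφm, Measure.restrict_eq_zero]
    exact ((isOpen_extChartAt_target (1 : L)).measure_pos lE
      ⟨φ 1, mem_extChartAt_target (1 : L)⟩).ne'
  have := measure_eq_zero_of_forall_preimage_mul_left μL _ hne horb.measurableSet fun a => by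
    rw [Measure.map_apply_of_aemeasurable hφm (measurable_const_mul a horb.measurableSet),
      Measure.restrict_apply' (isOpen_extChartAt_target (1 : L)).measurableSet, inter_comm]
    exact hchart a
  simpa only [orb, univ_inter] using this

end ConjugateNull

/-! ### Absolute continuity of the torus component -/

instance torusModel_boundaryless (n : ℕ) : (torusModel n).Boundaryless := by
  refine ⟨eq_univ_of_forall fun y => ⟨y, ?_⟩⟩
  funext i
  rfl

theorem theorem2p11 {E H L : Type*} [NormedAddCommGroup E] [NormedSpace ℝ E]
    [FiniteDimensional ℝ E] [TopologicalSpace H] (I : ModelWithCorners ℝ E H) [I.Boundaryless]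
    [Group L] [TopologicalSpace L] [ChartedSpace H L] [LieGroup I ∞ L]
    [T2Space L] [CompactSpace L] [ConnectedSpace L] [MeasurableSpace L] [BorelSpace L]
    (T : Subgroup L) (hT : IsMaximalTorus I T)
    (μL : Measure L) [μL.IsHaarMeasure] (μT : Measure T) [μT.IsHaarMeasure]
    {Ω : Type*} [MeasurableSpace Ω] (P : Measure Ω) [IsProbabilityMeasure P]
    (U : Ω → L) (hU : Measurable U) (V : Ω → L ⧸ T) (Z : Ω → T)
    (hVZ : IsRandomPreimage hT P U V Z) (hac : P.map U ≪ μL) :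
    P.map Z ≪ μT := by
  have : LieGroup I 1 L := LieGroup.of_le (n := ∞) (by exact_mod_cast le_top)
  have : IsTopologicalGroup L := topologicalGroup_of_lieGroup I 1
  have : SecondCountableTopology H := I.secondCountableTopology
  have : SecondCountableTopology L := ChartedSpace.secondCountable_of_sigmaCompact H L
  obtain ⟨n, f, hfinj, hf, hfd, hfT⟩ := hT.prop
  let : MeasurableSpace (Fin n → Circle) := borel _
  have : BorelSpace (Fin n → Circle) := ⟨rfl⟩
  have : CompactSpace T := by
    refine isCompact_iff_compactSpace.1 (?_ : IsCompact (T : Set L))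
    rw [← hfT, MonoidHom.coe_range]
    exact isCompact_range hf.continuous
  let g : (Fin n → Circle) ≃* T :=
    (MonoidHom.ofInjective hfinj).trans (MulEquiv.subgroupCongr hfT)
  have hgf : ∀ x, (g x : L) = f x := fun x => rfl
  have hgc : Continuous g := Continuous.subtype_mk hf.continuous _
  let G : (Fin n → Circle) ≃ₜ T := hgc.homeoOfEquivCompactToT2 (f := g.toEquiv)
  have hgs : Continuous g.symm := G.symm.continuous
  have : (μT.map g.symm).IsHaarMeasure :=
    g.symm.isHaarMeasure_map μT hgs (by simpa using hgc)
  have : SecondCountableTopology T :=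
    inferInstanceAs (SecondCountableTopology ((T : Set L) : Type _))
  have hfin : IsFiniteMeasure (P.map Z) := Measure.isFiniteMeasure_map P Z
  refine Measure.AbsolutelyContinuous.mk fun N hN hN0 => ?_
  -- For compact `K` the union of conjugates is closed, hence measurable, which a general measurable
  -- `N` would not give directly.
  rw [hN.measure_eq_iSup_isCompact]
  simp only [ENNReal.iSup_eq_zero]
  intro K hKN hK
  have hK0 : (μT.map g.symm) (g ⁻¹' K) = 0 := by
    rw [Measure.map_apply hgs.measurable (hgc.measurable hK.measurableSet), ← preimage_comp]
    have : (g ∘ g.symm : T → T) = id := by ext; simp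
    rw [this, preimage_id]
    exact measure_mono_null hKN hN0
  have hKc : IsCompact (g ⁻¹' K) := G.isCompact_preimage.2 hK
  have hnull := measure_conj_image_eq_zero I (torusModel n) f hf.continuous
    ((hf 1).of_le (by exact_mod_cast le_top)) (hfd 1) μL (μT.map g.symm) hKc hK0
  rw [Measure.map_apply hVZ.measurable_torus hK.measurableSet]
  have hA : IsClosed ((fun p : L × (Fin n → Circle) => p.1 * f p.2 * p.1⁻¹) ''
      (univ ×ˢ (g ⁻¹' K))) :=
    ((isCompact_univ.prod hKc).image
      (((continuous_fst.mul (hf.continuous.comp continuous_snd))).mul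
        continuous_fst.inv)).isClosed
  have hU0 := hac hnull
  rw [Measure.map_apply hU hA.measurableSet] at hU0
  refine measure_mono_null_ae ?_ hU0
  filter_upwards [hVZ.ae_mem] with x hx hxK
  obtain ⟨v, hv⟩ := QuotientGroup.mk_surjective (V x)
  have hUx : v * (Z x : L) * v⁻¹ = U x := by
    rw [← conjMap_mk hT, hv]
    exact hx
  refine ⟨(v, g.symm (Z x)), ⟨trivial, ?_⟩, ?_⟩
  · exact (congrArg (· ∈ K) (g.apply_symm_apply (Z x))).mpr hxK
  · simp only [← hgf, MulEquiv.apply_symm_apply]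
    exact hUx
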